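/- Let $\mathrm{PG}(2,\mathbb{R})$ be the real projective plane. A set $\mathcal S$ of points of $\mathrm{PG}(2,\mathbb R)$ is called a \emph{generalized KM-arc of type $(0,m,t)$}, where $m,t$ are non-negative integers, if it is a non-empty proper subset of the point set and each point $R\in\mathcal S$ is incident with a line meeting $\mathcal S$ in exactly $t$ points, while every other line through $R$ meets $\mathcal S$ in exactly $m$ points. (In a finite projective plane of order $q$ this is equivalent to: $\mathcal S$ has size $q(m-1)+t$ and meets each line in $0$, $m$ or $t$ points.) Then a finite set $\mathcal S$ of points of $\mathrm{PG}(2,\mathbb R)$ is a generalized KM-arc of type $(0,m,t)$ for some $m,t$ if and only if $\mathcal S$ is non-empty and contained in a line. The same holds if generalized KM-arcs of type $(0,m,t)$, $m\ge 1$, are instead defined as the non-empty proper point sets $\mathcal S$ with $|\mathcal S|=q(m-1)+t$ that meet each line in $0$, $m$ or $t$ points, where $q=|\mathbb R|$ and the size is computed in cardinal arithmetic. -/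

import Mathlib

open scoped LinearAlgebra.Projectivization

/-- The points of the projective plane `PG(2,K)`: the one-dimensional subspaces of `K³`. -/
abbrev PG2 (K : Type*) [Field K] : Type _ := ℙ K (Fin 3 → K)

/-- A line of `PG(2,K)`, as a set of points: all points contained in a fixed two-dimensional
linear subspace of `K³`. -/
def IsLine {K : Type*} [Field K] (l : Set (PG2 K)) : Prop :=
  ∃ W : Submodule K (Fin 3 → K), Module.finrank K W = 2 ∧ l = {P | P.submodule ≤ W}

/-- `l` is an `i`-secant of the point set `S`: a line meeting `S` in exactly `i` points. -/
def IsSecant {K : Type*} [Field K] (S : Set (PG2 K)) (i : ℕ) (l : Set (PG2 K)) : Prop :=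
  IsLine l ∧ (S ∩ l).encard = i

/-- Generalized KM-arc of type `(0,m,t)`, pointwise form: a proper non-empty point set `S` such
that every point of `S` is incident with a `t`-secant and all the other lines through that point
are `m`-secants. (In a finite plane of order `q` this is equivalent to `S` having size
`q(m-1)+t` and meeting each line in `0`, `m` or `t` points.) -/
def IsGeneralizedKMArc {K : Type*} [Field K] (S : Set (PG2 K)) (m t : ℕ) : Prop :=
  S.Nonempty ∧ S ≠ Set.univ ∧
    ∀ R ∈ S, ∃ l : Set (PG2 K), R ∈ l ∧ IsSecant S t l ∧
      ∀ l' : Set (PG2 K), IsLine l' → R ∈ l' → l' ≠ l → IsSecant S m l'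

/-- Generalized KM-arc of type `(0,m,t)`, size form: a proper non-empty point set of size
`q(m-1)+t` that meets each line in `0`, `m` or `t` points. Here `q` is the order of the plane,
that is, the cardinality of `K`; the size is computed in cardinal numbers, so that the definition
also makes sense for infinite planes. -/
def IsGeneralizedKMArcBySize {K : Type*} [Field K] (S : Set (PG2 K)) (m t : ℕ) : Prop :=
  S.Nonempty ∧ S ≠ Set.univ ∧
    1 ≤ m ∧ Cardinal.mk S = Cardinal.mk K * ((m - 1 : ℕ) : Cardinal) + (t : Cardinal) ∧
    ∀ l : Set (PG2 K), IsLine l → IsSecant S 0 l ∨ IsSecant S m l ∨ IsSecant S t l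

namespace PG2

variable {K : Type*} [Field K]

/-! Only the infinitude of the field matters. A point R of a finite set S lies on infinitely many
lines, finitely many of which meet S again, so some line other than the given `t`-secant is tangent
at R (`exists_isLine_inter_eq_singleton`). Hence m = 1, and a point of S off the `t`-secant would
give a second line through R with two points of S. In the size form, m ≥ 2 would make |S| infinite;
so m = 1 and t = |S|, and a line through two points of S must contain all of S. Conversely,
collinear sets have type (0, 1, |S|). -/

theorem finrank_sup_submodule {P Q : PG2 K} (h : P ≠ Q) :
    Module.finrank K ↥(P.submodule ⊔ Q.submodule) = 2 := by
  have hP := P.finrank_submodule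
  have hQ := Q.finrank_submodule
  have hsum := Submodule.finrank_sup_add_finrank_inf_eq P.submodule Q.submodule
  have hle := Submodule.finrank_mono (inf_le_left : P.submodule ⊓ Q.submodule ≤ P.submodule)
  have hne : Module.finrank K ↥(P.submodule ⊓ Q.submodule) ≠ 1 := by
    intro h1
    have e1 := Submodule.eq_of_le_of_finrank_eq
      (inf_le_left : P.submodule ⊓ Q.submodule ≤ P.submodule) (h1.trans hP.symm)
    have e2 := Submodule.eq_of_le_of_finrank_eq
      (inf_le_right : P.submodule ⊓ Q.submodule ≤ Q.submodule) (h1.trans hQ.symm)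
    exact h (Projectivization.submodule_injective (e1.symm.trans e2))
  omega

theorem eq_sup_submodule_of_finrank_eq_two {P Q : PG2 K} (h : P ≠ Q)
    {W : Submodule K (Fin 3 → K)} (hW : Module.finrank K W = 2)
    (hP : P.submodule ≤ W) (hQ : Q.submodule ≤ W) : W = P.submodule ⊔ Q.submodule :=
  (Submodule.eq_of_le_of_finrank_eq (sup_le hP hQ)
    ((finrank_sup_submodule h).trans hW.symm)).symm

theorem exists_isLine_of_ne {P Q : PG2 K} (h : P ≠ Q) : ∃ l, IsLine l ∧ P ∈ l ∧ Q ∈ l :=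
  ⟨_, ⟨_, finrank_sup_submodule h, rfl⟩,
    (le_sup_left : P.submodule ≤ P.submodule ⊔ Q.submodule),
    (le_sup_right : Q.submodule ≤ P.submodule ⊔ Q.submodule)⟩

/-- Two distinct lines have at most one point in common. -/
theorem _root_.IsLine.eq_of_mem {l l' : Set (PG2 K)} (hl : IsLine l) (hl' : IsLine l')
    {P Q : PG2 K} (h : P ≠ Q) (hP : P ∈ l) (hQ : Q ∈ l) (hP' : P ∈ l') (hQ' : Q ∈ l') :
    l = l' := by
  obtain ⟨W, hW, rfl⟩ := hl
  obtain ⟨W', hW', rfl⟩ := hl'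
  rw [eq_sup_submodule_of_finrank_eq_two h hW hP hQ,
    eq_sup_submodule_of_finrank_eq_two h hW' hP' hQ']

theorem _root_.IsLine.ne_univ {l : Set (PG2 K)} (hl : IsLine l) : l ≠ Set.univ := by
  obtain ⟨W, hW, rfl⟩ := hl
  intro hu
  have htop : W = ⊤ := by
    rw [eq_top_iff]
    intro v _
    by_cases hv : v = 0
    · simp [hv]
    have h : (Projectivization.mk K v hv).submodule ≤ W := Set.eq_univ_iff_forall.1 hu _
    rw [Projectivization.submodule_mk] at h
    exact h (Submodule.mem_span_singleton_self v)
  rw [htop, finrank_top, Module.finrank_fin_fun] at hW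
  omega

theorem sup_submodule_ne_top (P Q : PG2 K) : P.submodule ⊔ Q.submodule ≠ ⊤ := by
  intro h
  have hle := Submodule.finrank_add_le_finrank_add_finrank P.submodule Q.submodule
  rw [h, finrank_top, Module.finrank_fin_fun, P.finrank_submodule, Q.finrank_submodule] at hle
  omega

/-- Over an infinite field, a point of a finite set `S` lies on a tangent line to `S` different
from any prescribed line through that point. -/
theorem exists_isLine_inter_eq_singleton [Infinite K] {S : Set (PG2 K)} (hS : S.Finite)
    {R : PG2 K} (hR : R ∈ S) {l : Set (PG2 K)} (hl : IsLine l) (hRl : R ∈ l) :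
    ∃ l', IsLine l' ∧ R ∈ l' ∧ l' ≠ l ∧ S ∩ l' = {R} := by
  classical
  obtain ⟨W, hW, rfl⟩ := hl
  let s : Finset (Submodule K (Fin 3 → K)) :=
    insert W (hS.toFinset.image fun Q => R.submodule ⊔ Q.submodule)
  have hs : ⊤ ∉ s := by
    simp only [s, Finset.mem_insert, Finset.mem_image, not_or, not_exists, not_and]
    refine ⟨?_, fun Q _ => sup_submodule_ne_top R Q⟩
    rintro rfl
    rw [finrank_top, Module.finrank_fin_fun] at hW
    omega
  -- A vector space over an infinite field is not a finite union of proper subspaces. The tangent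
  -- will join R to the point spanned by v.
  obtain ⟨v, hv⟩ := (Set.ne_univ_iff_exists_notMem _).1
    (Subspace.biUnion_ne_univ_of_top_notMem hs)
  simp only [Set.mem_iUnion, not_exists] at hv
  have hvW : v ∉ W := hv W (Finset.mem_insert_self _ _)
  have hvS : ∀ Q ∈ S, v ∉ R.submodule ⊔ Q.submodule := fun Q hQ =>
    hv _ (Finset.mem_insert_of_mem (Finset.mem_image_of_mem _ (hS.mem_toFinset.2 hQ)))
  have hv0 : v ≠ 0 := by
    rintro rfl
    exact hvW W.zero_mem
  let V : PG2 K := Projectivization.mk K v hv0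
  have hvV : v ∈ V.submodule := by
    rw [Projectivization.submodule_mk]
    exact Submodule.mem_span_singleton_self v
  have hRV : R ≠ V := fun h => hvW (hRl (h ▸ hvV))
  obtain ⟨_, ⟨W', hW', rfl⟩, hRW', hVW'⟩ := exists_isLine_of_ne hRV
  refine ⟨_, ⟨W', hW', rfl⟩, hRW', ?_, ?_⟩
  · intro h
    rw [h] at hVW'
    exact hvW (hVW' hvV)
  · refine Set.Subset.antisymm ?_ (Set.singleton_subset_iff.2 ⟨hR, hRW'⟩)
    rintro Q ⟨hQ, hQW'⟩
    by_contra hne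
    -- A second point Q of S on the new line would make that line the join of R and Q, which avoids
    -- v.
    refine hvS Q hQ ?_
    rw [← eq_sup_submodule_of_finrank_eq_two (Ne.symm hne) hW' hRW' hQW']
    exact hVW' hvV

theorem exists_isLine_mem (P : PG2 K) : ∃ l, IsLine l ∧ P ∈ l := by
  obtain ⟨v, hv⟩ : ∃ v, v ∉ P.submodule := by
    by_contra! h
    exact sup_submodule_ne_top P P (by simpa using Submodule.eq_top_iff'.2 h)
  have hne : P ≠ Projectivization.mk K v (by rintro rfl; exact hv P.submodule.zero_mem) := by
    intro h
    rw [h, Projectivization.submodule_mk] at hv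
    exact hv (Submodule.mem_span_singleton_self v)
  obtain ⟨l, hl, hP, -⟩ := exists_isLine_of_ne hne
  exact ⟨l, hl, hP⟩

theorem inter_subsingleton {S l l' : Set (PG2 K)} (hl : IsLine l) (hl' : IsLine l')
    (hne : l' ≠ l) (hS : S ⊆ l) : (S ∩ l').Subsingleton := by
  intro P hP Q hQ
  by_contra h
  exact hne (hl'.eq_of_mem hl h hP.2 hQ.2 (hS hP.1) (hS hQ.1))

theorem ne_univ_of_subset_isLine {S l : Set (PG2 K)} (hl : IsLine l) (hS : S ⊆ l) :
    S ≠ Set.univ := by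
  rintro rfl
  exact hl.ne_univ (Set.univ_subset_iff.1 hS)

theorem encard_inter_of_subset {S l : Set (PG2 K)} (hfin : S.Finite) (hS : S ⊆ l) :
    (S ∩ l).encard = (S.ncard : ℕ∞) := by
  rw [Set.inter_eq_left.2 hS, hfin.cast_ncard_eq]

theorem isGeneralizedKMArc_of_subset_isLine {S l : Set (PG2 K)} (hfin : S.Finite)
    (hne : S.Nonempty) (hl : IsLine l) (hS : S ⊆ l) : IsGeneralizedKMArc S 1 S.ncard := by
  refine ⟨hne, ne_univ_of_subset_isLine hl hS, fun R hR =>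
    ⟨l, hS hR, ⟨hl, encard_inter_of_subset hfin hS⟩, fun l' hl' hRl' hne' => ⟨hl', ?_⟩⟩⟩
  rw [(inter_subsingleton hl hl' hne' hS).eq_singleton_of_mem ⟨hR, hRl'⟩]
  simp

theorem isGeneralizedKMArcBySize_of_subset_isLine {S l : Set (PG2 K)} (hfin : S.Finite)
    (hne : S.Nonempty) (hl : IsLine l) (hS : S ⊆ l) :
    IsGeneralizedKMArcBySize S 1 S.ncard := by
  refine ⟨hne, ne_univ_of_subset_isLine hl hS, le_rfl, ?_, fun l' hl' => ?_⟩
  · simp [Set.cast_ncard hfin]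
  · by_cases h : l' = l
    · subst h
      exact Or.inr (Or.inr ⟨hl', encard_inter_of_subset hfin hS⟩)
    · rcases (inter_subsingleton hl hl' h hS).eq_empty_or_singleton with h0 | ⟨P, h1⟩
      · exact Or.inl ⟨hl', by simp [h0]⟩
      · exact Or.inr (Or.inl ⟨hl', by simp [h1]⟩)

theorem _root_.IsGeneralizedKMArc.exists_isLine_subset [Infinite K] {S : Set (PG2 K)}
    {m t : ℕ} (h : IsGeneralizedKMArc S m t) (hfin : S.Finite) : ∃ l, IsLine l ∧ S ⊆ l := by
  obtain ⟨⟨R, hR⟩, -, harc⟩ := h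
  obtain ⟨l, hRl, ⟨hl, -⟩, hm⟩ := harc R hR
  obtain ⟨l₁, hl₁, hRl₁, hne₁, hinter⟩ := exists_isLine_inter_eq_singleton hfin hR hl hRl
  have hm1 : (m : ℕ∞) = 1 := by
    rw [← (hm l₁ hl₁ hRl₁ hne₁).2, hinter, Set.encard_singleton]
  refine ⟨l, hl, fun Q hQ => ?_⟩
  by_contra hQl
  have hRQ : R ≠ Q := fun h => hQl (h ▸ hRl)
  obtain ⟨l', hl', hRl', hQl'⟩ := exists_isLine_of_ne hRQ
  have hcard := (hm l' hl' hRl' (fun h => hQl (h ▸ hQl'))).2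
  rw [hm1] at hcard
  exact hRQ (Set.encard_le_one_iff.1 hcard.le _ _ ⟨hR, hRl'⟩ ⟨hQ, hQl'⟩)

theorem _root_.IsGeneralizedKMArcBySize.exists_isLine_subset [Infinite K] {S : Set (PG2 K)}
    {m t : ℕ} (h : IsGeneralizedKMArcBySize S m t) (hfin : S.Finite) :
    ∃ l, IsLine l ∧ S ⊆ l := by
  obtain ⟨⟨R, hR⟩, -, hm, hcard, hsec⟩ := h
  have hm1 : m = 1 := by
    by_contra hne
    have hlt : Cardinal.mk S < Cardinal.aleph0 := Cardinal.lt_aleph0_iff_set_finite.2 hfin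
    -- The bound 1 ≤ m is essential here: for m = 0 the truncated difference would vanish.
    have hpos : ((m - 1 : ℕ) : Cardinal) ≠ 0 := by
      rw [Nat.cast_ne_zero]
      omega
    rw [hcard] at hlt
    exact absurd hlt (not_lt.2 (((Cardinal.aleph0_le_mk K).trans
      (Cardinal.le_mul_right hpos)).trans le_self_add))
  subst hm1
  have ht : S.ncard = t := by
    have hcast := (Set.cast_ncard hfin).trans hcard
    rw [Nat.sub_self, Nat.cast_zero, mul_zero, zero_add] at hcast
    exact Nat.cast_injective hcast
  by_cases hQ : ∃ Q ∈ S, R ≠ Q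
  · obtain ⟨Q, hQ, hRQ⟩ := hQ
    obtain ⟨l, hl, hRl, hQl⟩ := exists_isLine_of_ne hRQ
    have hnot : ¬ (S ∩ l).encard ≤ 1 := fun hle =>
      hRQ (Set.encard_le_one_iff.1 hle _ _ ⟨hR, hRl⟩ ⟨hQ, hQl⟩)
    refine ⟨l, hl, ?_⟩
    rcases hsec l hl with h | h | h
    · exact absurd (by simp [h.2]) hnot
    · exact absurd (by simp [h.2]) hnot
    · rw [← Set.inter_eq_left]
      refine (hfin.subset Set.inter_subset_left).eq_of_subset_of_encard_le Set.inter_subset_left ?_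
      rw [h.2, ← ht, hfin.cast_ncard_eq]
  -- Here S = {R}, and any line through R works.
  · push Not at hQ
    obtain ⟨l, hl, hRl⟩ := exists_isLine_mem R
    exact ⟨l, hl, fun Q hQS => hQ Q hQS ▸ hRl⟩

end PG2

theorem corollary6p2 (S : Set (PG2 ℝ)) (hS : S.Finite) :
    ((∃ m t : ℕ, IsGeneralizedKMArc S m t) ↔
      S.Nonempty ∧ ∃ l : Set (PG2 ℝ), IsLine l ∧ S ⊆ l) ∧
    ((∃ m t : ℕ, IsGeneralizedKMArcBySize S m t) ↔
      S.Nonempty ∧ ∃ l : Set (PG2 ℝ), IsLine l ∧ S ⊆ l) := by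
  refine ⟨⟨?_, ?_⟩, ⟨?_, ?_⟩⟩
  · rintro ⟨m, t, h⟩
    exact ⟨h.1, h.exists_isLine_subset hS⟩
  · rintro ⟨hne, l, hl, hSl⟩
    exact ⟨_, _, PG2.isGeneralizedKMArc_of_subset_isLine hS hne hl hSl⟩
  · rintro ⟨m, t, h⟩
    exact ⟨h.1, h.exists_isLine_subset hS⟩
  · rintro ⟨hne, l, hl, hSl⟩
    exact ⟨_, _, PG2.isGeneralizedKMArcBySize_of_subset_isLine hS hne hl hSl⟩
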